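/- For integers $n > K \ge 1$, let $\mathbb{H}(n;K)$ be the random $K$-out graph on nodes $v_1,\dots,v_n$: independently for each $i$, the node $v_i$ selects a set $\Gamma_{n,i}$ uniformly at random among the $K$-element subsets of the other $n-1$ nodes, and distinct nodes $v_i, v_j$ are joined by an (undirected) edge if and only if $v_j \in \Gamma_{n,i}$ or $v_i \in \Gamma_{n,j}$. A set $S$ of nodes of a graph is \emph{$r$-reachable} if some node of $S$ has at least $r$ neighbours outside $S$; a graph is \emph{$r$-robust} if for every pair of nonempty disjoint sets of nodes at least one of the two is $r$-reachable. \textbf{Theorem (Ensuring $r$-robustness).} Fix an integer $K \ge 1$ and let $$r^\star(K) = \max\Bigl\{ r \in \{1,2,3,\dots\} : \lim_{n\to\infty} \mathbb{P}\bigl[\mathbb{H}(n;K) \text{ is } r\text{-robust}\bigr] = 1 \Bigr\},$$ with $r^\star(K) = 0$ if there is no such $r$. Then $$r^\star(K) \ge \lfloor K/2 \rfloor .$$ In other words, for every integer $r \ge 1$ with $K \ge 2r$, the graph $\mathbb{H}(n;K)$ is $r$-robust with probability tending to $1$ as $n \to \infty$. In particular, for $K \ge 2$ the set above is nonempty, and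 its maximum exists. -/

import Mathlib

open Filter Topology MeasureTheory ProbabilityTheory

/-- `S` is `r`-reachable in `G`: some node of `S` has at least `r` neighbours outside `S`. -/
def IsReachableSet {V : Type*} (G : SimpleGraph V) (r : ℕ) (S : Set V) : Prop :=
  ∃ i ∈ S, (r : ℕ∞) ≤ (G.neighborSet i \ S).encard

/-- `G` is `r`-robust: of any two nonempty disjoint sets of nodes, at least one is
`r`-reachable. -/
def IsRobust {V : Type*} (G : SimpleGraph V) (r : ℕ) : Prop :=
  ∀ S₁ S₂ : Set V, S₁.Nonempty → S₂.Nonempty → Disjoint S₁ S₂ →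
    IsReachableSet G r S₁ ∨ IsReachableSet G r S₂

/-- The joint law of the selections `Γ i`, `i : Fin n`: they are independent, and `Γ i` is uniform
among the `K`-element sets of nodes other than `i`. This is a probability measure for `K < n`. -/
noncomputable def selectionLaw (n K : ℕ) : Measure (Fin n → Finset (Fin n)) :=
  Measure.pi fun i => uniformOn {A : Finset (Fin n) | i ∉ A ∧ A.card = K}

/-- The graph induced by the selections `Γ`: distinct nodes `i`, `j` are adjacent if and only if
`j ∈ Γ i` or `i ∈ Γ j`. -/
def selectionGraph {n : ℕ} (Γ : Fin n → Finset (Fin n)) : SimpleGraph (Fin n) :=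
  SimpleGraph.fromRel fun i j => j ∈ Γ i

/-- The probability that the random `K`-out graph on `n` nodes is `r`-robust. -/
noncomputable def probRobust (n K r : ℕ) : ℝ :=
  (selectionLaw n K).real {Γ | IsRobust (selectionGraph Γ) r}

/-- The positive integers `r` such that the random `K`-out graph on `n` nodes is `r`-robust with
probability tending to one as `n → ∞`. -/
def robustLevels (K : ℕ) : Set ℕ :=
  {r | 1 ≤ r ∧ Tendsto (fun n : ℕ => probRobust n K r) atTop (𝓝 1)}

/-- The largest element of `robustLevels K` (and `0` if there is none). -/
noncomputable def rStar (K : ℕ) : ℕ := sSup (robustLevels K)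

/-!
Of two disjoint nonempty sets of nodes, one has at most `n / 2` elements. So it suffices that, with
probability tending to one, every set `S` with `1 ≤ |S| ≤ n / 2` is `r`-reachable, and this follows
from a union bound over `S`.

Fix `S` with `m = x * n` nodes. If `S` is not `r`-reachable, then every node of `S` has at most
`r - 1` neighbours outside `S`, so at most `(r - 1) * m` pairs of nodes are joined across the
boundary of `S`. Such a pair is either selected from inside `S`, or selected only from outside; see
`sum_card_crossing_le_of_not_isReachableSet`. For `0 < s ≤ 1` the probability is therefore at most
`s ^ (-(r - 1) * m)` times the expectation of `s` to the number of joined pairs. Condition on the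
selections of the nodes in `S`. A node `j` outside `S` then contributes the number of its selections
among those nodes of `S` that have not selected `j`, and these contributions are independent
(`Fintype.sum_piFinset_prod_mul_prod_compl_le`). A uniform `K`-subset is compared with `K`
independent uniform draws (`sum_powersetCard_pow_card_inter_le`). All the errors made (drawing
without replacement, `n - 1` in place of `n`, the at most `K * m` pairs already joined from inside)
amount to a constant factor depending on `K` only, and the result is
`ℙ[S is not r-reachable] ≤ exp (4 * K ^ 2) * escapeBound K r s x ^ m`
(`card_filter_not_isReachableSet_le`).

There are `n.choose m ≤ (e / x) ^ m` sets of size `m`. With the choice `s = 2 / 5 * x` and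
`K ≥ 2 * r`, the product `e / x * escapeBound K r s x` is at most `9 / 10` and at most `6 * x`, for
all `0 < x ≤ 1 / 2` (`exp_one_div_mul_escapeBound_le`). Hence the sum over `m` is dominated by a
geometric series while each of its terms tends to zero, and it tends to zero by dominated
convergence.

The set of admissible levels is bounded, because the in-degrees sum to `n * K`: some two cyclically
consecutive nodes both have small degree, and their singletons witness that the graph is never
`r`-robust for `r ≥ 3 * K + 1` (`not_isRobust_selectionGraph`).
-/

/-! ### Exponential moments of a uniform subset -/

theorem pow_succ_add_mul_pow_le_add_pow {s x : ℝ} (hs : 0 ≤ s) (hx : 0 ≤ x) (k : ℕ) :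
    s ^ (k + 1) + (k + 1) * x * s ^ k ≤ (s + x) ^ (k + 1) := by
  induction k with
  | zero => simp
  | succ k ih =>
    have h1 : 0 ≤ s ^ k := pow_nonneg hs k
    have h2 := mul_le_mul_of_nonneg_right ih (add_nonneg hs hx)
    rw [pow_succ (s + x) (k + 1)]
    refine le_trans ?_ h2
    have h3 : 0 ≤ (k + 1 : ℝ) * (x * x * s ^ k) := by positivity
    push_cast
    rw [pow_succ s (k + 1), pow_succ s k]
    nlinarith

/-- The elementary symmetric sums of nonnegative numbers are at most those of sampling with
replacement: each `K`-subset arises from `K!` of the terms of the expanded power. -/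
theorem Finset.sum_powersetCard_prod_le {α : Type*} [DecidableEq α] (U : Finset α) (x : α → ℝ)
    (hx : ∀ a, 0 ≤ x a) (k : ℕ) :
    ∑ A ∈ U.powersetCard k, ∏ a ∈ A, x a ≤ (∑ a ∈ U, x a) ^ k / k.factorial := by
  induction U using Finset.induction_on generalizing k with
  | empty =>
    cases k with
    | zero => simp
    | succ k => rw [Finset.powersetCard_eq_empty.2 (by simp)]; simp
  | insert a U ha ih =>
    cases k with
    | zero => simp
    | succ k =>
      rw [Finset.powersetCard_succ_insert ha, Finset.sum_union, Finset.sum_image]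
      · have h1 : ∑ A ∈ U.powersetCard k, ∏ b ∈ insert a A, x b
            = x a * ∑ A ∈ U.powersetCard k, ∏ b ∈ A, x b := by
          rw [Finset.mul_sum]
          refine Finset.sum_congr rfl fun A hA => ?_
          rw [Finset.prod_insert fun h => ha ((Finset.mem_powersetCard.1 hA).1 h)]
        rw [h1, Finset.sum_insert ha]
        refine (add_le_add (ih (k + 1)) (mul_le_mul_of_nonneg_left (ih k) (hx a))).trans ?_
        have h2 := pow_succ_add_mul_pow_le_add_pow
          (Finset.sum_nonneg fun b (_ : b ∈ U) => hx b) (hx a) k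
        rw [add_comm (x a)]
        refine le_trans (le_of_eq ?_) (div_le_div_of_nonneg_right h2 (by positivity))
        rw [Nat.factorial_succ]
        push_cast
        have : (k.factorial : ℝ) ≠ 0 := by positivity
        field_simp
      · intro A hA B hB hAB
        have hA' : a ∉ A := fun h => ha ((Finset.mem_powersetCard.1 hA).1 h)
        have hB' : a ∉ B := fun h => ha ((Finset.mem_powersetCard.1 hB).1 h)
        rw [← Finset.erase_insert hA', ← Finset.erase_insert hB']
        exact congrArg (Finset.erase · a) hAB
      · rw [Finset.disjoint_left]
        intro A hA hA'
        obtain ⟨B, -, rfl⟩ := Finset.mem_image.1 hA'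
        exact ha ((Finset.mem_powersetCard.1 hA).1 (Finset.mem_insert_self a B))

/-- The cost of sampling with replacement, for a single node. The factor is small enough that its
`n`-th power, the cost for all nodes together, is a constant. -/
theorem pow_div_factorial_le_choose_mul_exp {n K : ℕ} (hK : 1 ≤ K) (hn : 2 * K ≤ n) :
    ((n - 1 : ℕ) : ℝ) ^ K / K.factorial
      ≤ (n - 1).choose K * Real.exp (2 * K ^ 2 / n) := by
  have hf : (0 : ℝ) < K.factorial := by positivity
  rw [div_le_iff₀ hf]
  have h1 : ((n - 1 + 1 - K : ℕ) : ℝ) ^ K ≤ (n - 1).choose K * K.factorial := by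
    have := Nat.pow_sub_le_descFactorial (n - 1) K
    rw [Nat.descFactorial_eq_factorial_mul_choose, mul_comm] at this
    exact_mod_cast this
  have h2 : ((n - 1 : ℕ) : ℝ) ≤ ((n - 1 + 1 - K : ℕ) : ℝ) * Real.exp (2 * K / n) := by
    have e : ((n - 1 + 1 - K : ℕ) : ℝ) = n - K := by
      rw [Nat.sub_add_cancel (by omega), Nat.cast_sub (by omega)]
    have hn' : (2 * K : ℝ) ≤ n := by exact_mod_cast hn
    have hK' : (1 : ℝ) ≤ K := by exact_mod_cast hK
    rw [e, Nat.cast_sub (by omega)]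
    have h3 : 1 + 2 * (K : ℝ) / n ≤ Real.exp (2 * K / n) := by
      linarith [Real.add_one_le_exp (2 * (K : ℝ) / n)]
    refine le_trans ?_ (mul_le_mul_of_nonneg_left h3 (by linarith))
    have hn0 : (0 : ℝ) < n := by linarith
    have : (n - K : ℝ) * (1 + 2 * K / n) = n + K - 2 * K * K / n := by field_simp; ring
    rw [this]
    have : 2 * (K : ℝ) * K / n ≤ K := by
      rw [div_le_iff₀ hn0]; nlinarith
    push_cast
    linarith
  calc ((n - 1 : ℕ) : ℝ) ^ K ≤ (((n - 1 + 1 - K : ℕ) : ℝ) * Real.exp (2 * K / n)) ^ K :=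
        pow_le_pow_left₀ (by positivity) h2 K
    _ = ((n - 1 + 1 - K : ℕ) : ℝ) ^ K * Real.exp (2 * K ^ 2 / n) := by
        rw [mul_pow, ← Real.exp_nat_mul]; congr 2; ring
    _ ≤ _ := by
        have := mul_le_mul_of_nonneg_right h1 (Real.exp_pos (2 * (K : ℝ) ^ 2 / n)).le
        linarith

/-- Up to the factor `exp (2 * K ^ 2 / n)`, the exponential moment of the number of elements of `T`
in a uniform `K`-subset of `U` is bounded by that of a binomial variable. -/
theorem sum_powersetCard_pow_card_inter_le {α : Type*} [DecidableEq α] {n K : ℕ} (hK : 1 ≤ K)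
    (hn : 2 * K ≤ n) {U T : Finset α} (hU : U.card = n - 1) (hT : T ⊆ U) {s : ℝ} (hs : 0 ≤ s) :
    ∑ A ∈ U.powersetCard K, s ^ (A ∩ T).card ≤
      (n - 1).choose K * Real.exp (2 * K ^ 2 / n) *
        (1 - (1 - s) * (T.card / (n - 1 : ℕ))) ^ K := by
  have hN : (0 : ℝ) < (n - 1 : ℕ) := by
    have : 0 < n - 1 := by omega
    exact_mod_cast this
  have h1 : ∀ A : Finset α, s ^ (A ∩ T).card = ∏ a ∈ A, if a ∈ T then s else 1 := by
    intro A
    rw [Finset.prod_ite, Finset.prod_const, Finset.prod_const_one, mul_one,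
      Finset.filter_mem_eq_inter]
  have h2 : ∑ a ∈ U, (if a ∈ T then s else 1)
      = (n - 1 : ℕ) * (1 - (1 - s) * (T.card / (n - 1 : ℕ))) := by
    rw [Finset.sum_ite, Finset.filter_mem_eq_inter, Finset.inter_eq_right.2 hT,
      Finset.filter_notMem_eq_sdiff, Finset.sum_const, Finset.sum_const,
      Finset.card_sdiff_of_subset hT, nsmul_eq_mul, nsmul_eq_mul,
      Nat.cast_sub (Finset.card_le_card hT), hU]
    field_simp
    ring
  have h3 : 0 ≤ 1 - (1 - s) * (T.card / (n - 1 : ℕ)) := by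
    have : (0 : ℝ) ≤ ∑ a ∈ U, (if a ∈ T then s else 1) :=
      Finset.sum_nonneg fun a _ => by split_ifs <;> linarith
    rw [h2] at this
    exact nonneg_of_mul_nonneg_right this hN
  simp_rw [h1]
  refine (Finset.sum_powersetCard_prod_le U _ (fun a => by split_ifs <;> linarith) K).trans ?_
  rw [h2, mul_pow, mul_div_right_comm]
  exact mul_le_mul_of_nonneg_right (pow_div_factorial_le_choose_mul_exp hK hn) (pow_nonneg h3 K)

/-! ### Conditioning on the coordinates in a set -/

/-- A form of Fubini's theorem for functions on a finite product: the coordinates outside `S` are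
summed first, with the factors `h` allowed to depend on the coordinates in `S`. -/
theorem Fintype.sum_piFinset_prod_mul_prod_compl_le {ι α : Type*} [Fintype ι] [DecidableEq ι]
    [Fintype α] [Inhabited α] [DecidableEq α] (S : Finset ι) (V : ι → Finset α) (f : ι → α → ℝ)
    (hf : ∀ i a, 0 ≤ f i a) (h : (ι → α) → ι → α → ℝ)
    (hdep : ∀ Γ Γ' : ι → α, (∀ i ∈ S, Γ i = Γ' i) → h Γ = h Γ') {M : ℝ}
    (hM : ∀ Γ : ι → α, (∀ i ∈ S, Γ i ∈ V i) → ∏ j ∈ Sᶜ, ∑ a ∈ V j, h Γ j a ≤ M) :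
    ∑ Γ ∈ Fintype.piFinset V, (∏ i ∈ S, f i (Γ i)) * ∏ j ∈ Sᶜ, h Γ j (Γ j)
      ≤ (∏ i ∈ S, ∑ a ∈ V i, f i a) * M := by
  classical
  let e := Equiv.piEquivPiSubtypeProd (fun i => i ∈ S) (fun _ : ι => α)
  let F : ({i // i ∈ S} → α) → ℝ := fun g =>
    ∏ i : {i // i ∈ S}, if g i ∈ V i then f i (g i) else 0
  -- The coordinates outside `S` are filled in arbitrarily; by `hdep` this does not affect `h`.
  let ext : ({i // i ∈ S} → α) → (ι → α) := fun g => e.symm (g, fun _ => default)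
  let H : ({i // i ∈ S} → α) → {i // i ∉ S} → α → ℝ := fun g j a =>
    if a ∈ V j then h (ext g) j a else 0
  have hext : ∀ g (i : {i // i ∈ S}), ext g i = g i := fun g i => by
    simp [ext, e, Equiv.piEquivPiSubtypeProd]
  have hprod : ∀ u : ι → ℝ, ∏ j ∈ Sᶜ, u j = ∏ j : {j // j ∉ S}, u j := fun u =>
    Finset.prod_subtype _ (fun j => by simp) u
  have hprod' : ∀ u : ι → ℝ, ∏ j ∈ S, u j = ∏ j : {j // j ∈ S}, u j := fun u =>
    Finset.prod_subtype _ (fun j => by simp) u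
  have hF : ∀ g, 0 ≤ F g := fun g =>
    Finset.prod_nonneg fun i _ => by split_ifs <;> simp [hf]
  have key : ∀ p : ({i // i ∈ S} → α) × ({i // i ∉ S} → α),
      (if e.symm p ∈ Fintype.piFinset V then
        (∏ i ∈ S, f i (e.symm p i)) * ∏ j ∈ Sᶜ, h (e.symm p) j (e.symm p j) else 0)
        = F p.1 * ∏ j, H p.1 j (p.2 j) := by
    rintro ⟨g, k⟩
    have e1 : ∀ i : {i // i ∈ S}, e.symm (g, k) i = g i := fun i => by
      simp [e, Equiv.piEquivPiSubtypeProd]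
    have e2 : ∀ j : {j // j ∉ S}, e.symm (g, k) j = k j := fun j => by
      simp [e, Equiv.piEquivPiSubtypeProd, j.2]
    have e3 : h (e.symm (g, k)) = h (ext g) := hdep _ _ fun i hi => by
      rw [e1 ⟨i, hi⟩, hext g ⟨i, hi⟩]
    split_ifs with hm
    · rw [Fintype.mem_piFinset] at hm
      rw [hprod, hprod', e3]
      congr 1
      · refine Finset.prod_congr rfl fun i _ => ?_
        have := hm i
        rw [e1] at this
        rw [e1, if_pos this]
      · refine Finset.prod_congr rfl fun j _ => ?_
        have := hm j
        rw [e2] at this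
        simp only [H]
        rw [e2, if_pos this]
    · rw [Fintype.mem_piFinset] at hm
      push Not at hm
      obtain ⟨i, hi⟩ := hm
      by_cases hS : i ∈ S
      · rw [e1 ⟨i, hS⟩] at hi
        have : F g = 0 := Finset.prod_eq_zero (Finset.mem_univ ⟨i, hS⟩) (if_neg hi)
        rw [this, zero_mul]
      · rw [e2 ⟨i, hS⟩] at hi
        have : ∏ j, H g j (k j) = 0 :=
          Finset.prod_eq_zero (Finset.mem_univ ⟨i, hS⟩) (if_neg hi)
        simp only [this, mul_zero]
  have hsum : ∑ Γ ∈ Fintype.piFinset V, (∏ i ∈ S, f i (Γ i)) * ∏ j ∈ Sᶜ, h Γ j (Γ j)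
      = ∑ g, F g * ∏ j, ∑ a, H g j a := by
    rw [← Finset.univ_inter (Fintype.piFinset V), ← Finset.sum_ite_mem, ← e.symm.sum_comp,
      Fintype.sum_prod_type]
    refine Finset.sum_congr rfl fun g _ => ?_
    rw [Fintype.prod_sum, Finset.mul_sum]
    exact Finset.sum_congr rfl fun k _ => key (g, k)
  rw [hsum]
  have hle : ∀ g, F g * ∏ j, ∑ a, H g j a ≤ F g * M := by
    intro g
    by_cases hg : ∀ i : {i // i ∈ S}, g i ∈ V i
    · refine mul_le_mul_of_nonneg_left ?_ (hF g)
      have := hM (ext g) fun i hi => by rw [hext g ⟨i, hi⟩]; exact hg ⟨i, hi⟩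
      rw [hprod] at this
      refine le_trans (le_of_eq ?_) this
      refine Finset.prod_congr rfl fun j _ => ?_
      simp [H, Finset.sum_ite_mem]
    · push Not at hg
      obtain ⟨i, hi⟩ := hg
      have : F g = 0 := Finset.prod_eq_zero (Finset.mem_univ i) (if_neg hi)
      rw [this, zero_mul, zero_mul]
  refine (Finset.sum_le_sum fun g _ => hle g).trans (le_of_eq ?_)
  rw [← Finset.sum_mul, hprod']
  congr 1
  rw [← Fintype.prod_sum (fun (i : {i // i ∈ S}) a => if a ∈ V i then f i a else 0)]
  refine Finset.prod_congr rfl fun i _ => ?_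
  simp [Finset.sum_ite_mem]


/-! ### The selections as a finite probability space -/

/-- The selections available to node `i`: the `K`-element sets of other nodes. -/
def selections (n K : ℕ) (i : Fin n) : Finset (Finset (Fin n)) :=
  (Finset.univ.erase i).powersetCard K

theorem mem_selections {n K : ℕ} {i : Fin n} {A : Finset (Fin n)} :
    A ∈ selections n K i ↔ i ∉ A ∧ A.card = K := by
  simp [selections, Finset.mem_powersetCard, Finset.subset_erase]

theorem card_piFinset_selections (n K : ℕ) :
    (Fintype.piFinset (selections n K)).card = (n - 1).choose K ^ n := by
  simp [Fintype.card_piFinset, selections, Finset.card_powersetCard]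

open Classical in
/-- The law of the selections is the uniform law on the finite product of the sets of available
selections, so probabilities are quotients of cardinalities. -/
theorem selectionLaw_real_setOf (n K : ℕ) (p : (Fin n → Finset (Fin n)) → Prop) :
    (selectionLaw n K).real {Γ | p Γ} =
      (((Fintype.piFinset (selections n K)).filter p).card : ℝ) / (n - 1).choose K ^ n := by
  have h1 : selectionLaw n K = uniformOn (Fintype.piFinset (selections n K) : Set _) := by
    rw [Fintype.coe_piFinset, uniformOn_pi, selectionLaw]
    congr 1
    funext i
    congr 1
    ext A
    simp [mem_selections]
  have h2 : {Γ | p Γ} = ((Finset.univ.filter p : Finset (Fin n → Finset (Fin n))) : Set _) := by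
    simp
  rw [h1, h2, Measure.real, uniformOn_apply_finset, card_piFinset_selections,
    Finset.inter_filter, Finset.inter_univ]
  simp

/-! ### The probability that a given set is not reachable -/

/-- If `S` is not `r`-reachable, few pairs are joined across its boundary. The pairs selected from
inside `S` are left out of the second sum, so that no pair is counted twice. -/
theorem sum_card_crossing_le_of_not_isReachableSet {n r : ℕ}
    (Γ : Fin n → Finset (Fin n)) (S : Finset (Fin n))
    (h : ¬ IsReachableSet (selectionGraph Γ) r (S : Set (Fin n))) :
    ∑ i ∈ S, (Γ i ∩ Sᶜ).card + ∑ j ∈ Sᶜ, (Γ j ∩ S.filter (j ∉ Γ ·)).card ≤ (r - 1) * S.card := by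
  have h1 : ∀ i ∈ S, (Γ i ∩ Sᶜ).card + (Sᶜ.filter fun j => i ∈ Γ j ∧ j ∉ Γ i).card ≤ r - 1 := by
    intro i hi
    rw [← Finset.card_union_of_disjoint]
    · by_contra hc
      refine h ⟨i, hi, ?_⟩
      have hc' : r ≤ (Γ i ∩ Sᶜ ∪ Sᶜ.filter fun j => i ∈ Γ j ∧ j ∉ Γ i).card := by omega
      refine le_trans (Nat.cast_le.2 hc') ?_
      rw [← Set.encard_coe_eq_coe_finsetCard]
      refine Set.encard_le_encard fun j hj => ?_
      simp only [Finset.coe_union, Set.mem_union, Finset.mem_coe, Finset.mem_inter,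
        Finset.mem_compl, Finset.mem_filter] at hj
      have hjS : j ∉ S := by tauto
      refine ⟨?_, hjS⟩
      rw [SimpleGraph.mem_neighborSet, selectionGraph, SimpleGraph.fromRel_adj]
      exact ⟨fun e => hjS (e ▸ hi), by tauto⟩
    · rw [Finset.disjoint_left]
      intro j hj hj'
      exact (Finset.mem_filter.1 hj').2.2 (Finset.mem_inter.1 hj).1
  have h2 : ∑ j ∈ Sᶜ, (Γ j ∩ S.filter (j ∉ Γ ·)).card
      = ∑ i ∈ S, (Sᶜ.filter fun j => i ∈ Γ j ∧ j ∉ Γ i).card := by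
    refine Eq.trans ?_ (Finset.sum_card_bipartiteAbove_eq_sum_card_bipartiteBelow
      (fun i j => i ∈ Γ j ∧ j ∉ Γ i) (s := S) (t := Sᶜ)).symm
    refine Finset.sum_congr rfl fun j _ => congrArg _ ?_
    ext i
    simp only [Finset.mem_inter, Finset.mem_filter, Finset.mem_bipartiteBelow]
    tauto
  rw [h2, ← Finset.sum_add_distrib, mul_comm, ← smul_eq_mul]
  exact Finset.sum_le_card_nsmul _ _ _ h1

/-- At most `K * |S|` of the pairs across the boundary of `S` are selected from inside `S`; the
remaining ones are still available to the nodes outside. -/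
theorem mul_card_compl_le_sum_card_filter {n K : ℕ} {Γ : Fin n → Finset (Fin n)}
    {S : Finset (Fin n)} (hΓ : ∀ i ∈ S, (Γ i).card = K) :
    S.card * Sᶜ.card ≤ ∑ j ∈ Sᶜ, (S.filter (j ∉ Γ ·)).card + K * S.card := by
  have h := Finset.sum_card_bipartiteAbove_eq_sum_card_bipartiteBelow
    (fun i j => j ∉ Γ i) (s := S) (t := Sᶜ)
  simp only [Finset.bipartiteBelow, Finset.bipartiteAbove] at h
  rw [← h, mul_comm K, ← smul_eq_mul, ← smul_eq_mul, ← Finset.sum_const, ← Finset.sum_const,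
    ← Finset.sum_add_distrib]
  refine Finset.sum_le_sum fun i hi => ?_
  have := Finset.le_card_sdiff (Γ i) Sᶜ
  rw [hΓ i hi] at this
  rw [← Finset.sdiff_eq_filter]
  omega

/-- The contribution of the nodes outside `S`, conditionally on the selections of the nodes in `S`.
-/
theorem prod_compl_sum_selections_le {n K : ℕ} (hK : 1 ≤ K) (hn : 2 * K ≤ n)
    {S : Finset (Fin n)} {s : ℝ} (hs0 : 0 < s) (hs1 : s ≤ 1) {Γ : Fin n → Finset (Fin n)}
    (hΓ : ∀ i ∈ S, Γ i ∈ selections n K i) :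
    ∏ j ∈ Sᶜ, ∑ A ∈ selections n K j, s ^ (A ∩ S.filter (j ∉ Γ ·)).card ≤
      ((n - 1).choose K * Real.exp (2 * K ^ 2 / n)) ^ Sᶜ.card *
        (Real.exp (2 * K ^ 2) * Real.exp (-(K * (1 - s) * (1 - S.card / n))) ^ S.card) := by
  set D : ℝ := (n - 1).choose K * Real.exp (2 * K ^ 2 / n) with hD
  have hN : (0 : ℝ) < (n - 1 : ℕ) := by
    have : 0 < n - 1 := by omega
    exact_mod_cast this
  have hn0 : (0 : ℝ) < n := by
    have : 0 < n := by omega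
    exact_mod_cast this
  have hN2 : (n : ℝ) ≤ 2 * (n - 1 : ℕ) := by
    have : n ≤ 2 * (n - 1) := by omega
    exact_mod_cast this
  have hNn : ((n - 1 : ℕ) : ℝ) ≤ n := by exact_mod_cast Nat.sub_le n 1
  have hm : (S.card : ℝ) ≤ n := by
    have := Finset.card_le_univ S
    rw [Fintype.card_fin] at this
    exact_mod_cast this
  have h1 : ∀ j ∈ Sᶜ, ∑ A ∈ selections n K j, s ^ (A ∩ S.filter (j ∉ Γ ·)).card ≤
      D * Real.exp (-(K * (1 - s) / (n - 1 : ℕ) * (S.filter (j ∉ Γ ·)).card)) := by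
    intro j hj
    have hj' : j ∉ S := Finset.mem_compl.1 hj
    have hT : S.filter (j ∉ Γ ·) ⊆ Finset.univ.erase j := by
      rw [Finset.subset_erase]
      exact ⟨Finset.subset_univ _, fun h => hj' (Finset.mem_filter.1 h).1⟩
    have hU : (Finset.univ.erase j).card = n - 1 := by simp
    refine (sum_powersetCard_pow_card_inter_le hK hn hU hT hs0.le).trans ?_
    refine mul_le_mul_of_nonneg_left ?_ (by positivity)
    have h2 : ((S.filter (j ∉ Γ ·)).card : ℝ) / (n - 1 : ℕ) ≤ 1 := by
      rw [div_le_one hN]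
      have := Finset.card_le_card hT
      rw [hU] at this
      exact_mod_cast this
    have h3 : 0 ≤ ((S.filter (j ∉ Γ ·)).card : ℝ) / (n - 1 : ℕ) := by positivity
    calc _ ≤ Real.exp (-((1 - s) * ((S.filter (j ∉ Γ ·)).card / (n - 1 : ℕ)))) ^ K := by
          refine pow_le_pow_left₀ (by nlinarith) ?_ K
          exact Real.one_sub_le_exp_neg _
      _ = _ := by
          rw [← Real.exp_nat_mul]
          congr 1
          ring
  refine (Finset.prod_le_prod (fun j _ => Finset.sum_nonneg fun A _ => by positivity) h1).trans ?_
  rw [Finset.prod_mul_distrib, Finset.prod_const, ← Real.exp_sum]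
  refine mul_le_mul_of_nonneg_left ?_ (by positivity)
  rw [← Real.exp_nat_mul, ← Real.exp_add, Real.exp_le_exp, Finset.sum_neg_distrib,
    ← Finset.mul_sum]
  have h4 := mul_card_compl_le_sum_card_filter (K := K) (S := S) (Γ := Γ)
    fun i hi => (mem_selections.1 (hΓ i hi)).2
  have h5 : (S.card : ℝ) * (n - S.card) - K * S.card
      ≤ ∑ j ∈ Sᶜ, ((S.filter (j ∉ Γ ·)).card : ℝ) := by
    have : (S.card : ℝ) * Sᶜ.card ≤ ∑ j ∈ Sᶜ, ((S.filter (j ∉ Γ ·)).card : ℝ) + K * S.card := by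
      exact_mod_cast h4
    rw [Finset.card_compl, Fintype.card_fin, Nat.cast_sub (by exact_mod_cast hm)] at this
    linarith
  -- The pairs already joined from inside `S` cost a constant factor in total, as `|S| ≤ n`.
  have h6 : 0 ≤ K * (1 - s) / (n - 1 : ℕ) :=
    div_nonneg (mul_nonneg (by positivity) (by linarith)) hN.le
  have h7 := mul_le_mul_of_nonneg_left h5 h6
  have h8 : K * (1 - s) / (n - 1 : ℕ) * (K * S.card) ≤ 2 * (K : ℝ) ^ 2 := by
    rw [div_mul_eq_mul_div, div_le_iff₀ hN]
    have a1 : (S.card : ℝ) ≤ 2 * (n - 1 : ℕ) := hm.trans hN2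
    have a2 : (1 - s) * S.card ≤ 2 * (n - 1 : ℕ) := by
      nlinarith [Nat.cast_nonneg (α := ℝ) S.card]
    have a3 := mul_le_mul_of_nonneg_left a2 (sq_nonneg (K : ℝ))
    linarith
  have h9 : S.card * (K * (1 - s) * (1 - S.card / n))
      ≤ K * (1 - s) / (n - 1 : ℕ) * (S.card * (n - S.card)) := by
    have b1 : (1 - S.card / n : ℝ) ≤ (n - S.card) / (n - 1 : ℕ) := by
      rw [one_sub_div hn0.ne']
      exact div_le_div_of_nonneg_left (by linarith) hN hNn
    have b2 : 0 ≤ S.card * (K * (1 - s)) :=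
      mul_nonneg (by positivity) (mul_nonneg (by positivity) (by linarith))
    have b3 := mul_le_mul_of_nonneg_left b1 b2
    refine le_trans (le_of_eq (by ring)) (b3.trans (le_of_eq (by ring)))
  rw [mul_sub] at h7
  linarith

/-- The contribution of a single node of `S`. -/
theorem sum_selections_le {n K : ℕ} (hK : 1 ≤ K) (hn : 2 * K ≤ n)
    {S : Finset (Fin n)} {s : ℝ} (hs0 : 0 < s) (hs1 : s ≤ 1) {i : Fin n} (hi : i ∈ S) :
    ∑ A ∈ selections n K i, s ^ (A ∩ Sᶜ).card ≤
      (n - 1).choose K * Real.exp (2 * K ^ 2 / n) *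
        (S.card / n + s * (1 - S.card / n)) ^ K := by
  have hN : (0 : ℝ) < (n - 1 : ℕ) := by
    have : 0 < n - 1 := by omega
    exact_mod_cast this
  have hn0 : (0 : ℝ) < n := by
    have : 0 < n := by omega
    exact_mod_cast this
  have hNn : ((n - 1 : ℕ) : ℝ) ≤ n := by exact_mod_cast Nat.sub_le n 1
  have hm : S.card ≤ n := by
    have := Finset.card_le_univ S
    rwa [Fintype.card_fin] at this
  have hT : Sᶜ ⊆ Finset.univ.erase i := by
    rw [Finset.subset_erase]
    exact ⟨Finset.subset_univ _, fun h => Finset.mem_compl.1 h hi⟩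
  have hU : (Finset.univ.erase i).card = n - 1 := by simp
  refine (sum_powersetCard_pow_card_inter_le hK hn hU hT hs0.le).trans ?_
  refine mul_le_mul_of_nonneg_left ?_ (by positivity)
  have h2 : (Sᶜ.card : ℝ) / (n - 1 : ℕ) ≤ 1 := by
    rw [div_le_one hN]
    have := Finset.card_le_card hT
    rw [hU] at this
    exact_mod_cast this
  have h3 : 0 ≤ (Sᶜ.card : ℝ) / (n - 1 : ℕ) := by positivity
  have b1 : (1 - S.card / n : ℝ) ≤ Sᶜ.card / (n - 1 : ℕ) := by
    rw [one_sub_div hn0.ne', Finset.card_compl, Fintype.card_fin, Nat.cast_sub hm]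
    exact div_le_div_of_nonneg_left (by simpa using hm) hN hNn
  refine pow_le_pow_left₀ (by nlinarith) ?_ K
  nlinarith

/-- The bound on the probability that a given set of `m = x * n` nodes is not `r`-reachable,
up to a constant factor, is the `m`-th power of this quantity; `s` is the free parameter of the
exponential moment. -/
noncomputable def escapeBound (K r : ℕ) (s x : ℝ) : ℝ :=
  (s ^ (r - 1))⁻¹ * ((x + s * (1 - x)) ^ K * Real.exp (-(K * (1 - s) * (1 - x))))

open Classical in
/-- The bound on the probability that `S` is not `r`-reachable, multiplied by the number of possible
selections. -/
theorem card_filter_not_isReachableSet_le {n K r : ℕ} (hK : 1 ≤ K) (hn : 2 * K ≤ n)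
    (S : Finset (Fin n)) {s : ℝ} (hs0 : 0 < s) (hs1 : s ≤ 1) :
    (((Fintype.piFinset (selections n K)).filter fun Γ =>
      ¬ IsReachableSet (selectionGraph Γ) r (S : Set (Fin n))).card : ℝ) ≤
      (n - 1).choose K ^ n *
        (Real.exp (4 * K ^ 2) * escapeBound K r s (S.card / n) ^ S.card) := by
  set D : ℝ := (n - 1).choose K * Real.exp (2 * K ^ 2 / n) with hD
  have hn0 : (n : ℝ) ≠ 0 := by
    have : n ≠ 0 := by omega
    exact_mod_cast this
  have hm : S.card ≤ n := by
    have := Finset.card_le_univ S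
    rwa [Fintype.card_fin] at this
  have h1 : (((Fintype.piFinset (selections n K)).filter fun Γ =>
      ¬ IsReachableSet (selectionGraph Γ) r (S : Set (Fin n))).card : ℝ) ≤
      ∑ Γ ∈ Fintype.piFinset (selections n K), (s ^ ((r - 1) * S.card))⁻¹ *
        ((∏ i ∈ S, s ^ (Γ i ∩ Sᶜ).card) *
          ∏ j ∈ Sᶜ, s ^ (Γ j ∩ S.filter (j ∉ Γ ·)).card) := by
    rw [Finset.card_filter, Nat.cast_sum]
    refine Finset.sum_le_sum fun Γ _ => ?_
    split_ifs with h
    · rw [Nat.cast_zero]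
      positivity
    · have h2 := sum_card_crossing_le_of_not_isReachableSet Γ S h
      rw [Finset.prod_pow_eq_pow_sum, Finset.prod_pow_eq_pow_sum, ← pow_add, Nat.cast_one,
        le_inv_mul_iff₀ (by positivity), mul_one]
      exact pow_le_pow_of_le_one hs0.le hs1 h2
  have h3 := Fintype.sum_piFinset_prod_mul_prod_compl_le S (selections n K)
    (fun _ A => s ^ (A ∩ Sᶜ).card) (fun _ _ => by positivity)
    (fun Γ j A => s ^ (A ∩ S.filter (j ∉ Γ ·)).card)
    (fun Γ Γ' h => by
      funext j A
      congr 3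
      exact Finset.filter_congr fun i hi => by rw [h i hi])
    (fun Γ hΓ => prod_compl_sum_selections_le hK hn hs0 hs1 hΓ)
  have h4 : ∏ i ∈ S, ∑ A ∈ selections n K i, s ^ (A ∩ Sᶜ).card ≤
      (D * (S.card / n + s * (1 - S.card / n)) ^ K) ^ S.card := by
    rw [← Finset.prod_const]
    exact Finset.prod_le_prod (fun i _ => Finset.sum_nonneg fun A _ => by positivity)
      fun i hi => sum_selections_le hK hn hs0 hs1 hi
  refine h1.trans ?_
  rw [← Finset.mul_sum]
  refine (mul_le_mul_of_nonneg_left (h3.trans (mul_le_mul_of_nonneg_right h4 (by positivity)))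
    (by positivity)).trans (le_of_eq ?_)
  have h5 : D ^ S.card * D ^ Sᶜ.card = (n - 1).choose K ^ n * Real.exp (2 * K ^ 2) := by
    rw [← pow_add, Finset.card_add_card_compl, Fintype.card_fin, hD, mul_pow, ← Real.exp_nat_mul,
      mul_div_cancel₀ _ hn0]
  have h6 : Real.exp (4 * K ^ 2) = Real.exp (2 * K ^ 2) * Real.exp (2 * K ^ 2) := by
    rw [← Real.exp_add]
    congr 1
    ring
  rw [h6, escapeBound, mul_pow, mul_pow _ (_ ^ K * _), mul_pow _ (Real.exp _) S.card,
    pow_mul s, inv_pow]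
  linear_combination ((s ^ (r - 1)) ^ S.card)⁻¹ *
    (((S.card : ℝ) / n + s * (1 - S.card / n)) ^ K) ^ S.card * Real.exp (2 * K ^ 2) *
    Real.exp (-(K * (1 - s) * (1 - S.card / n))) ^ S.card * h5


/-! ### The numerical estimate -/

theorem exp_neg_four_fifths_le : Real.exp (-(4 / 5)) ≤ 5 / 11 := by
  rw [Real.exp_neg, inv_le_comm₀ (Real.exp_pos _) (by norm_num)]
  have h1 : Real.exp (4 / 5) ^ 5 = Real.exp 1 ^ 4 := by
    rw [← Real.exp_nat_mul, ← Real.exp_nat_mul]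
    norm_num
  refine le_of_pow_le_pow_left₀ (n := 5) (by norm_num) (Real.exp_pos _).le ?_
  rw [h1]
  refine le_trans (by norm_num) (pow_le_pow_left₀ (by norm_num)
    (Real.exp_one_gt_d9.le.trans' (by norm_num : (2.7 : ℝ) ≤ 2.7182818283)) 4)

theorem escapeBound_nonneg {K r : ℕ} {s x : ℝ} (hs : 0 ≤ s) (hx0 : 0 ≤ x) (hx1 : x ≤ 1) :
    0 ≤ escapeBound K r s x := by
  have : 0 ≤ x + s * (1 - x) := add_nonneg hx0 (mul_nonneg hs (by linarith))
  unfold escapeBound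
  positivity

/-- The moment parameter is taken proportional to `x`: for small `x` this exploits that nearly all
selections of the nodes in `S` must fall into the small set `S`. The constant `2 / 5` makes the bound
less than one at `x = 1 / 2`, the worst case, for all `r` at once. -/
theorem exp_one_div_mul_escapeBound_le {K r : ℕ} (hr : 1 ≤ r) (hK : 2 * r ≤ K) {x : ℝ}
    (hx0 : 0 < x) (hx : x ≤ 1 / 2) :
    Real.exp 1 / x * escapeBound K r (2 / 5 * x) x ≤ min (9 / 10) (6 * x) := by
  obtain ⟨s, hs⟩ : ∃ s : ℝ, s = 2 / 5 * x := ⟨_, rfl⟩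
  rw [← hs]
  have hs0 : 0 < s := by rw [hs]; positivity
  set y : ℝ := (x + s * (1 - x)) * Real.exp (-((1 - s) * (1 - x))) with hy
  have hb0 : 0 ≤ x + s * (1 - x) := by nlinarith
  have hy0 : 0 ≤ y := mul_nonneg hb0 (Real.exp_pos _).le
  have hy1 : y ≤ 1 := by
    refine mul_le_one₀ (by nlinarith) (Real.exp_pos _).le ?_
    rw [Real.exp_le_one_iff]
    nlinarith
  -- The bound is essentially `exp 1 * (2 / 5) * g ^ r`, since `K ≥ 2 * r` and `y ≤ 1`.
  set g : ℝ := s⁻¹ * y ^ 2 with hg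
  have hg0 : 0 ≤ g := by positivity
  have hgx : g = 5 / 2 * (x * (7 / 5 - 2 / 5 * x) ^ 2)
      * Real.exp (-(2 * ((1 - s) * (1 - x)))) := by
    have : Real.exp (-(2 * ((1 - s) * (1 - x)))) = Real.exp (-((1 - s) * (1 - x))) ^ 2 := by
      rw [← Real.exp_nat_mul]
      congr 1
      push_cast
      ring
    rw [hg, hy, this, mul_pow, hs]
    field_simp
    ring
  have hexp : Real.exp (-(2 * ((1 - s) * (1 - x)))) ≤ 5 / 11 := by
    refine le_trans (Real.exp_le_exp.2 ?_) exp_neg_four_fifths_le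
    nlinarith
  have hcub : x * (7 / 5 - 2 / 5 * x) ^ 2 ≤ 18 / 25 := by
    nlinarith [mul_nonneg hx0.le (sub_nonneg.2 hx),
      mul_nonneg (mul_nonneg hx0.le hx0.le) (sub_nonneg.2 hx)]
  have hcub' : x * (7 / 5 - 2 / 5 * x) ^ 2 ≤ 2 * x := by nlinarith
  have hcub0 : 0 ≤ x * (7 / 5 - 2 / 5 * x) ^ 2 := by positivity
  have he0 := (Real.exp_pos (-(2 * ((1 - s) * (1 - x))))).le
  have hg1 : g ≤ 9 / 11 := by
    rw [hgx]
    calc _ ≤ 5 / 2 * (18 / 25) * (5 / 11) :=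
          mul_le_mul (by linarith) hexp he0 (by norm_num)
      _ = 9 / 11 := by norm_num
  have hg2 : g ≤ 5 * x := by
    rw [hgx]
    calc _ ≤ 5 / 2 * (2 * x) * 1 :=
          mul_le_mul (by linarith) (by linarith) he0 (by linarith)
      _ = 5 * x := by ring
  have hE : escapeBound K r s x ≤ s * g := by
    have h1 : escapeBound K r s x = (s ^ (r - 1))⁻¹ * y ^ K := by
      rw [escapeBound, hy, mul_pow, ← Real.exp_nat_mul]
      congr 4
      ring
    have h2 : (s ^ (r - 1))⁻¹ * y ^ (2 * r) = s * g ^ r := by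
      obtain ⟨q, rfl⟩ := Nat.exists_eq_add_of_le' hr
      rw [hg, mul_pow s⁻¹, pow_mul, Nat.add_sub_cancel, pow_succ s⁻¹ q, inv_pow]
      field_simp
    rw [h1]
    calc _ ≤ (s ^ (r - 1))⁻¹ * y ^ (2 * r) :=
          mul_le_mul_of_nonneg_left (pow_le_pow_of_le_one hy0 hy1 hK) (by positivity)
      _ = s * g ^ r := h2
      _ ≤ s * g := mul_le_mul_of_nonneg_left
          (pow_le_of_le_one hg0 (by linarith) (by omega)) hs0.le
  have hfin : Real.exp 1 / x * escapeBound K r s x ≤ Real.exp 1 * (2 / 5) * g := by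
    refine (mul_le_mul_of_nonneg_left hE (by positivity)).trans (le_of_eq ?_)
    rw [hs]
    field_simp
  have he : Real.exp 1 < 2.7182818286 := Real.exp_one_lt_d9
  refine hfin.trans (le_min ?_ ?_)
  · nlinarith [Real.exp_pos 1]
  · nlinarith [Real.exp_pos 1]

/-! ### The union bound -/

theorem choose_le_exp_one_div_pow (n m : ℕ) (hm : 1 ≤ m) :
    (n.choose m : ℝ) ≤ (Real.exp 1 / (m / n)) ^ m := by
  have hm0 : (m : ℝ) ≠ 0 := by
    have : m ≠ 0 := by omega
    exact_mod_cast this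
  have h1 := Real.pow_div_factorial_le_exp (m : ℝ) (by positivity) m
  calc (n.choose m : ℝ) ≤ n ^ m / m.factorial := Nat.choose_le_pow_div m n
    _ = (n / m) ^ m * (m ^ m / m.factorial) := by
        rw [div_pow]
        field_simp
    _ ≤ (n / m) ^ m * Real.exp m := by gcongr
    _ = _ := by
        rw [div_div_eq_mul_div, mul_div_assoc, mul_pow, ← Real.exp_nat_mul, mul_one, mul_comm]

open Classical in
theorem probRobust_eq_one_sub {n K r : ℕ} (hn : K + 1 ≤ n) :
    probRobust n K r = 1 - (((Fintype.piFinset (selections n K)).filter fun Γ =>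
      ¬ IsRobust (selectionGraph Γ) r).card : ℝ) / (n - 1).choose K ^ n := by
  have hpos : (0 : ℝ) < (n - 1).choose K := by
    exact_mod_cast Nat.choose_pos (by omega)
  have h := Finset.card_filter_add_card_filter_not (s := Fintype.piFinset (selections n K))
    (fun Γ => IsRobust (selectionGraph Γ) r)
  rw [card_piFinset_selections] at h
  have h' : (((Fintype.piFinset (selections n K)).filter fun Γ =>
      IsRobust (selectionGraph Γ) r).card : ℝ) +
      ((Fintype.piFinset (selections n K)).filter fun Γ =>
        ¬ IsRobust (selectionGraph Γ) r).card = (n - 1).choose K ^ n := by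
    exact_mod_cast h
  rw [probRobust, selectionLaw_real_setOf, eq_sub_iff_add_eq, ← add_div, h',
    div_self (by positivity)]

/-- The smaller of two disjoint sets violating robustness has at most `n / 2` elements. -/
theorem exists_finset_of_not_isRobust {n r : ℕ} {G : SimpleGraph (Fin n)} (h : ¬ IsRobust G r) :
    ∃ S : Finset (Fin n), 1 ≤ S.card ∧ 2 * S.card ≤ n ∧ ¬ IsReachableSet G r (S : Set (Fin n)) := by
  classical
  unfold IsRobust at h
  push Not at h
  obtain ⟨S₁, S₂, h1, h2, hd, hr1, hr2⟩ := h
  have hd' : Disjoint S₁.toFinset S₂.toFinset := Set.disjoint_toFinset.2 hd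
  have hc := Finset.card_le_univ (S₁.toFinset ∪ S₂.toFinset)
  rw [Finset.card_union_of_disjoint hd', Fintype.card_fin] at hc
  rcases le_total S₁.toFinset.card S₂.toFinset.card with hle | hle
  · exact ⟨S₁.toFinset, Finset.card_pos.2 (Set.toFinset_nonempty.2 h1), by omega, by simpa⟩
  · exact ⟨S₂.toFinset, Finset.card_pos.2 (Set.toFinset_nonempty.2 h2), by omega, by simpa⟩

open Classical in
/-- The union bound for the probability that the graph is not `r`-robust. The index `m` stands for
sets of size `m + 1`. -/
theorem card_filter_not_isRobust_le {n K r : ℕ} (hr : 1 ≤ r) (hK : 2 * r ≤ K) (hn : 2 * K ≤ n) :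
    (((Fintype.piFinset (selections n K)).filter fun Γ =>
      ¬ IsRobust (selectionGraph Γ) r).card : ℝ) / (n - 1).choose K ^ n ≤
      Real.exp (4 * K ^ 2) *
        ∑ m ∈ Finset.range (n / 2), min (9 / 10) (6 * ((m + 1 : ℕ) / n : ℝ)) ^ (m + 1) := by
  have hpos : (0 : ℝ) < (n - 1).choose K := by
    exact_mod_cast Nat.choose_pos (by omega)
  have hn0 : (0 : ℝ) < n := by
    have : 0 < n := by omega
    exact_mod_cast this
  rw [div_le_iff₀ (by positivity)]
  have hsub : (Fintype.piFinset (selections n K)).filter (fun Γ =>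
      ¬ IsRobust (selectionGraph Γ) r) ⊆
      (Finset.range (n / 2)).biUnion fun m =>
        ((Finset.univ : Finset (Fin n)).powersetCard (m + 1)).biUnion fun S =>
        (Fintype.piFinset (selections n K)).filter fun Γ =>
          ¬ IsReachableSet (selectionGraph Γ) r (S : Set (Fin n)) := by
    intro Γ hΓ
    rw [Finset.mem_filter] at hΓ
    obtain ⟨S, h1, h2, h3⟩ := exists_finset_of_not_isRobust hΓ.2
    refine Finset.mem_biUnion.2 ⟨S.card - 1, Finset.mem_range.2 (by omega), ?_⟩
    refine Finset.mem_biUnion.2 ⟨S, ?_, Finset.mem_filter.2 ⟨hΓ.1, h3⟩⟩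
    rw [Finset.mem_powersetCard_univ]
    omega
  have hcard := (Finset.card_le_card hsub).trans (Finset.card_biUnion_le.trans
    (Finset.sum_le_sum fun m _ => Finset.card_biUnion_le))
  refine (Nat.cast_le.2 hcard).trans ?_
  push_cast
  rw [Finset.mul_sum, Finset.sum_mul]
  refine Finset.sum_le_sum fun m hm => ?_
  have hm2 : 2 * (m + 1) ≤ n := by
    have := Finset.mem_range.1 hm
    omega
  set x : ℝ := ((m + 1 : ℕ) : ℝ) / n with hx
  have hx0 : 0 < x := by positivity
  have hx1 : x ≤ 1 / 2 := by
    have : 2 * ((m + 1 : ℕ) : ℝ) ≤ n := by exact_mod_cast hm2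
    rw [hx, div_le_iff₀ hn0]
    linarith
  have hE0 : 0 ≤ escapeBound K r (2 / 5 * x) x :=
    escapeBound_nonneg (by positivity) hx0.le (by linarith)
  have h1 : ∀ S ∈ (Finset.univ : Finset (Fin n)).powersetCard (m + 1),
      (((Fintype.piFinset (selections n K)).filter fun Γ =>
        ¬ IsReachableSet (selectionGraph Γ) r (S : Set (Fin n))).card : ℝ) ≤
      (n - 1).choose K ^ n *
        (Real.exp (4 * K ^ 2) * escapeBound K r (2 / 5 * x) x ^ (m + 1)) := by
    intro S hS
    have := card_filter_not_isReachableSet_le (r := r) (by omega) hn S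
      (s := 2 / 5 * x) (by positivity) (by linarith)
    rwa [Finset.mem_powersetCard_univ.1 hS, ← hx] at this
  refine (Finset.sum_le_sum h1).trans ?_
  rw [Finset.sum_const, Finset.card_powersetCard, Finset.card_univ, Fintype.card_fin, nsmul_eq_mul]
  have h2 : (n.choose (m + 1) : ℝ) * escapeBound K r (2 / 5 * x) x ^ (m + 1)
      ≤ min (9 / 10) (6 * x) ^ (m + 1) := by
    calc _ ≤ (Real.exp 1 / x) ^ (m + 1) * escapeBound K r (2 / 5 * x) x ^ (m + 1) :=
          mul_le_mul_of_nonneg_right (choose_le_exp_one_div_pow n (m + 1) (by omega))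
            (by positivity)
      _ = (Real.exp 1 / x * escapeBound K r (2 / 5 * x) x) ^ (m + 1) := (mul_pow _ _ _).symm
      _ ≤ _ := pow_le_pow_left₀ (by positivity) (exp_one_div_mul_escapeBound_le hr hK hx0 hx1) _
  have h3 := mul_le_mul_of_nonneg_left h2
    (show (0 : ℝ) ≤ Real.exp (4 * K ^ 2) * (n - 1).choose K ^ n by positivity)
  have hx' : ((m : ℝ) + 1) / n = x := by rw [hx]; push_cast; rfl
  simp only [hx']
  linarith

theorem tendsto_tsum_min_pow :
    Tendsto (fun n : ℕ => ∑' m : ℕ, min (9 / 10) (6 * ((m + 1 : ℕ) / n : ℝ)) ^ (m + 1))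
      atTop (𝓝 0) := by
  have h := tendsto_tsum_of_dominated_convergence (𝓕 := (atTop : Filter ℕ))
    (f := fun n m => min (9 / 10) (6 * ((m + 1 : ℕ) / n : ℝ)) ^ (m + 1))
    (g := fun _ => (0 : ℝ)) (bound := fun m => (9 / 10 : ℝ) ^ (m + 1))
    ((summable_nat_add_iff 1).2 (summable_geometric_of_lt_one (by norm_num) (by norm_num)))
    (fun m => by
      have h1 : Tendsto (fun n : ℕ => 6 * ((m + 1 : ℕ) / n : ℝ)) atTop (𝓝 (6 * 0)) :=
        (tendsto_const_div_atTop_nhds_zero_nat _).const_mul _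
      have h2 := ((tendsto_const_nhds (x := (9 / 10 : ℝ))).min h1).pow (m + 1)
      rwa [mul_zero, min_eq_right (by norm_num), zero_pow (Nat.succ_ne_zero m)] at h2)
    (Eventually.of_forall fun n m => by
      have h0 : 0 ≤ min (9 / 10) (6 * ((m + 1 : ℕ) / n : ℝ)) := le_min (by norm_num) (by positivity)
      rw [Real.norm_of_nonneg (pow_nonneg h0 _)]
      exact pow_le_pow_left₀ h0 (min_le_left _ _) _)
  simpa using h

theorem sum_range_min_pow_le_tsum (n : ℕ) :
    ∑ m ∈ Finset.range (n / 2), min (9 / 10) (6 * ((m + 1 : ℕ) / n : ℝ)) ^ (m + 1) ≤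
      ∑' m : ℕ, min (9 / 10) (6 * ((m + 1 : ℕ) / n : ℝ)) ^ (m + 1) := by
  have h0 : ∀ m : ℕ, 0 ≤ min (9 / 10) (6 * ((m + 1 : ℕ) / n : ℝ)) :=
    fun m => le_min (by norm_num) (by positivity)
  refine Summable.sum_le_tsum _ (fun m _ => pow_nonneg (h0 m) _) ?_
  exact Summable.of_nonneg_of_le (fun m => pow_nonneg (h0 m) _)
    (fun m => pow_le_pow_left₀ (h0 m) (min_le_left _ _) _)
    ((summable_nat_add_iff 1).2 (summable_geometric_of_lt_one (by norm_num)
      (by norm_num : (9 / 10 : ℝ) < 1)))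

theorem tendsto_probRobust {K r : ℕ} (hr : 1 ≤ r) (hK : 2 * r ≤ K) :
    Tendsto (fun n : ℕ => probRobust n K r) atTop (𝓝 1) := by
  classical
  have hlow : Tendsto (fun n : ℕ => 1 - Real.exp (4 * K ^ 2) *
      ∑' m : ℕ, min (9 / 10) (6 * ((m + 1 : ℕ) / n : ℝ)) ^ (m + 1)) atTop (𝓝 1) := by
    simpa using (tendsto_tsum_min_pow.const_mul (Real.exp (4 * K ^ 2))).const_sub 1
  refine tendsto_of_tendsto_of_tendsto_of_le_of_le' hlow tendsto_const_nhds ?_ ?_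
  · filter_upwards [eventually_ge_atTop (2 * K)] with n hn
    rw [probRobust_eq_one_sub (by omega)]
    have h1 := card_filter_not_isRobust_le hr hK hn
    have h2 := mul_le_mul_of_nonneg_left (sum_range_min_pow_le_tsum n)
      (Real.exp_pos (4 * (K : ℝ) ^ 2)).le
    linarith
  · filter_upwards [eventually_ge_atTop (2 * K)] with n hn
    rw [probRobust_eq_one_sub (by omega)]
    exact sub_le_self _ (by positivity)

/-! ### Boundedness of the admissible levels -/

theorem le_encard_neighborSet_of_isReachableSet_singleton {V : Type*} {G : SimpleGraph V} {r : ℕ}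
    {v : V} (h : IsReachableSet G r {v}) : (r : ℕ∞) ≤ (G.neighborSet v).encard := by
  obtain ⟨i, rfl, hi⟩ := h
  exact hi.trans (Set.encard_le_encard Set.sdiff_subset)

theorem encard_neighborSet_selectionGraph_le {n : ℕ} (Γ : Fin n → Finset (Fin n)) (v : Fin n) :
    ((selectionGraph Γ).neighborSet v).encard
      ≤ ((Γ v).card + (Finset.univ.filter (v ∈ Γ ·)).card : ℕ) := by
  refine le_trans ?_ (Nat.cast_le.2 (Finset.card_union_le _ _))
  rw [← Set.encard_coe_eq_coe_finsetCard]
  refine Set.encard_le_encard fun w hw => ?_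
  rw [SimpleGraph.mem_neighborSet, selectionGraph, SimpleGraph.fromRel_adj] at hw
  simpa using hw.2

/-- Robustness applied to the singletons of `v` and `v + 1` forces one of the two to have in-degree
at least `2 * K + 1`. Summing over `v` contradicts that the in-degrees add up to `(n + 2) * K`. -/
theorem not_isRobust_selectionGraph {n K r : ℕ} (hr : 3 * K + 1 ≤ r)
    {Γ : Fin (n + 2) → Finset (Fin (n + 2))} (hΓ : ∀ i, (Γ i).card = K) :
    ¬ IsRobust (selectionGraph Γ) r := by
  intro h
  let d : Fin (n + 2) → ℕ := fun v => (Finset.univ.filter (v ∈ Γ ·)).card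
  have hdeg : ∀ v, IsReachableSet (selectionGraph Γ) r {v} → 2 * K + 1 ≤ d v := by
    intro v hv
    have := (le_encard_neighborSet_of_isReachableSet_singleton hv).trans
      (encard_neighborSet_selectionGraph_le Γ v)
    rw [Nat.cast_le, hΓ] at this
    change r ≤ K + d v at this
    omega
  have hpair : ∀ v, 2 * K + 1 ≤ d v + d (v + 1) := by
    intro v
    have hne : v ≠ v + 1 := by simp
    rcases h {v} {v + 1} (Set.singleton_nonempty _) (Set.singleton_nonempty _)
      (Set.disjoint_singleton.2 hne) with h1 | h1
    · have := hdeg _ h1; omega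
    · have := hdeg _ h1; omega
  have hsum : ∑ v, d v = (n + 2) * K := by
    have := Finset.sum_card_bipartiteAbove_eq_sum_card_bipartiteBelow
      (fun v i => v ∈ Γ i) (s := Finset.univ) (t := Finset.univ)
    simp only [Finset.bipartiteAbove, Finset.bipartiteBelow] at this
    simp only [d, this]
    simp [hΓ]
  have hshift : ∑ v, d (v + 1) = ∑ v, d v := Equiv.sum_comp (Equiv.addRight (1 : Fin (n + 2))) d
  have hle : (n + 2) * (2 * K + 1) ≤ ∑ v, (d v + d (v + 1)) :=
    by simpa using Finset.card_nsmul_le_sum Finset.univ _ _ fun v _ => hpair v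
  rw [Finset.sum_add_distrib, hshift, hsum] at hle
  nlinarith

theorem lt_of_mem_robustLevels {K r : ℕ} (h : r ∈ robustLevels K) : r < 3 * K + 1 := by
  classical
  by_contra! hr
  have h0 : Tendsto (fun n : ℕ => probRobust n K r) atTop (𝓝 0) := by
    refine tendsto_const_nhds.congr' ?_
    filter_upwards [eventually_ge_atTop 2] with n hn
    obtain ⟨n, rfl⟩ := Nat.exists_eq_add_of_le' hn
    rw [probRobust, selectionLaw_real_setOf, Finset.filter_false_of_mem]
    · simp
    · intro Γ hΓ
      rw [Fintype.mem_piFinset] at hΓ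
      exact not_isRobust_selectionGraph hr fun i => (mem_selections.1 (hΓ i)).2
  exact zero_ne_one (tendsto_nhds_unique h0 h.2)

theorem bddAbove_robustLevels (K : ℕ) : BddAbove (robustLevels K) :=
  ⟨3 * K + 1, fun _ h => (lt_of_mem_robustLevels h).le⟩

/-! ### The robustness theorem -/

theorem mainTheorem4 (K : ℕ) (hK : 1 ≤ K) :
    (∀ r : ℕ, 1 ≤ r → 2 * r ≤ K →
      Tendsto (fun n : ℕ => probRobust n K r) atTop (𝓝 1)) ∧
    (2 ≤ K → IsGreatest (robustLevels K) (rStar K)) ∧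
    K / 2 ≤ rStar K := by
  refine ⟨fun r hr hrK => tendsto_probRobust hr hrK, fun h2 => ?_, ?_⟩
  · have hne : (robustLevels K).Nonempty := ⟨1, le_rfl, tendsto_probRobust le_rfl (by omega)⟩
    exact ⟨Nat.sSup_mem hne (bddAbove_robustLevels K),
      fun r hr => le_csSup (bddAbove_robustLevels K) hr⟩
  · rcases Nat.eq_zero_or_pos (K / 2) with h0 | hpos
    · rw [h0]
      exact Nat.zero_le _
    · exact le_csSup (bddAbove_robustLevels K) ⟨hpos, tendsto_probRobust hpos (by omega)⟩
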